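/- For $n,v\in\mathbb N$ let $\mathrm{RM}(n,v)$ be the binary code of block length $2^n$ whose codewords are the evaluations on $\mathbb F_2^n$ of the polynomials in $n$ variables over $\mathbb F_2$ of degree at most $v$; its rate is its dimension divided by $2^n$. A binary memoryless symmetric (BMS) channel is given by two output laws $W(\cdot\mid 0)$, $W(\cdot\mid 1)$ on a measurable space $\mathcal Y$ that are exchanged by a measurable involution of $\mathcal Y$, used independently for each transmitted bit; with $p(\cdot\mid b)$ denoting the density of $W(\cdot\mid b)$ with respect to a common dominating measure $\nu$, its Bhattacharyya parameter is $\int\sqrt{p(y\mid 0)\,p(y\mid 1)}\,d\nu(y)$. For a codeword transmitted uniformly at random from a code $\mathcal C$, the randomized block-MAP decoder outputs, on channel output $y$, each codeword $x\in\mathcal C$ with its posterior probability $p(x\mid y)=p(y\mid x)/\sum_{\tilde x\in\mathcal C}p(y\mid\tilde x)$. Let $R,z\in(0,1)$ and consider a sequence of codes $\mathrm{RM}(n,v_n)$, with $n$ tending to infinity along the sequence, whose rates $R_n$ converge to $R$. Assume that each code is transmitted over a BMS channel with Bhattacharyya parameter $z$. (The channel may depend on $n$, but $z$ does not.) Then,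 for every fixed $\beta>0$, the probability that the randomized block-MAP decoder outputs an incorrect codeword at Hamming distance at most $2^{n(1-\beta)}$ from the transmitted codeword tends to $0$ as $n$ tends to infinity. -/

import Mathlib

open MeasureTheory Filter Topology
open scoped ENNReal

noncomputable section

/-- A binary-input channel with output alphabet `Y` is given by its two output laws `W 0` and
`W 1`; it is symmetric if a measurable involution of the output alphabet exchanges them.
The output alphabet is an arbitrary measurable space, so that both discrete and continuous
channels are covered. -/
structure IsBMS {Y : Type*} [MeasurableSpace Y] (W : ZMod 2 → Measure Y) : Prop where
  isProbabilityMeasure : ∀ b, IsProbabilityMeasure (W b)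
  symmetric : ∃ τ : Y → Y, Measurable τ ∧ Function.Involutive τ ∧ W 1 = (W 0).map τ

/-- The transition density `p(y | b)` of the channel, with respect to the dominating measure
`W 0 + W 1`. -/
def channelDensity {Y : Type*} [MeasurableSpace Y] (W : ZMod 2 → Measure Y) (b : ZMod 2) (y : Y) :
    ℝ≥0∞ :=
  (W b).rnDeriv (W 0 + W 1) y

/-- The Bhattacharyya parameter `∫ √(p(y | 0) p(y | 1)) dy`. -/
def bhattacharyya {Y : Type*} [MeasurableSpace Y] (W : ZMod 2 → Measure Y) : ℝ :=
  ∫ y, √((channelDensity W 0 y).toReal * (channelDensity W 1 y).toReal) ∂(W 0 + W 1)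

/-- The law of the channel output when the word `x` is sent by independent uses of the channel. -/
def outputLaw {Y : Type*} [MeasurableSpace Y] {ι : Type*} [Fintype ι]
    (W : ZMod 2 → Measure Y) (x : ι → ZMod 2) : Measure (ι → Y) :=
  Measure.pi fun i => W (x i)

/-- The transition density `p(y | x) = ∏ i, p(y i | x i)` of the memoryless channel. -/
def wordDensity {Y : Type*} [MeasurableSpace Y] {ι : Type*} [Fintype ι]
    (W : ZMod 2 → Measure Y) (x : ι → ZMod 2) (y : ι → Y) : ℝ≥0∞ :=
  ∏ i, channelDensity W (x i) (y i)

/-- The posterior probability `p(x | y)` of the codeword `x` given the channel output `y`, when the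
transmitted codeword is uniformly distributed over the code `C`. -/
def codePosterior {Y : Type*} [MeasurableSpace Y] {ι : Type*} [Fintype ι]
    (W : ZMod 2 → Measure Y) (C : Finset (ι → ZMod 2)) (x : ι → ZMod 2) (y : ι → Y) : ℝ≥0∞ :=
  wordDensity W x y / ∑ x' ∈ C, wordDensity W x' y

/-- The probability that the randomized block-MAP decoder, which on output `y` returns each
codeword `x'` with probability `p(x' | y)`, returns an incorrect codeword at Hamming distance at
most `r` from the transmitted codeword `x`, where `x` is uniformly distributed over `C`. -/
def randBlockMAPErrorWithin {Y : Type*} [MeasurableSpace Y] {ι : Type*} [Fintype ι]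
    [DecidableEq ι] (W : ZMod 2 → Measure Y) (C : Finset (ι → ZMod 2)) (r : ℝ) : ℝ≥0∞ :=
  ∑ x ∈ C, (C.card : ℝ≥0∞)⁻¹ *
    ∫⁻ y, ∑ x' ∈ C with x' ≠ x ∧ (hammingDist x' x : ℝ) ≤ r, codePosterior W C x' y
      ∂(outputLaw W x)

/-- The Reed-Muller code `RM(n, v)`: the evaluations on `𝔽₂ⁿ` of the polynomials in `n` variables
of total degree at most `v` over `𝔽₂`. -/
def reedMuller (n v : ℕ) : Submodule (ZMod 2) ((Fin n → ZMod 2) → ZMod 2) :=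
  (MvPolynomial.restrictTotalDegree (Fin n) (ZMod 2) v).map
    (MvPolynomial.evalₗ (ZMod 2) (Fin n))

/-- The set of codewords of `RM(n, v)`. -/
def reedMullerCodewords (n v : ℕ) : Finset ((Fin n → ZMod 2) → ZMod 2) :=
  (Set.toFinite (reedMuller n v : Set ((Fin n → ZMod 2) → ZMod 2))).toFinset

/-- The rate of `RM(n, v)`: its dimension divided by its block length `2 ^ n`. -/
def reedMullerRate (n v : ℕ) : ℝ :=
  (Module.finrank (ZMod 2) (reedMuller n v) : ℝ) / 2 ^ n

end

/-! ### The Bhattacharyya union bound -/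

section Channel

/-! Linearity and a union bound reduce the error to `∑ z ^ wt c` over nonzero codewords `c` of
weight at most `2 ^ (n (1 - β))` (`randBlockMAPErrorWithin_le`), so few codewords of low weight must
be shown to exist.

Split the `n` variables as `k + m` and let `16 * wt f ≤ 2 ^ m`. For a random linear map `B : 𝔽₂ᵏ →
𝔽₂ᵐ`, the fold `g c = ∑ a, f (a, c + B a)` satisfies `g (c + B a) = f (a, c)` except with
probability at most `1/16`. Hence `n + 1` maps exist whose folds determine `f` by majority vote at
every point (`exists_majorityDecode_eq`). Summing out `k` variables lowers the degree by `k`, so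
each fold lies in `RM(m, v - k)`, or vanishes if `v < k`. This counts the words of low weight
(`card_lowWeight_reedMuller_le`).

A limiting rate below `1` forces `v ≤ (1 + δ) n / 2` eventually. In the weight range considered `k`
is at least of order `β n`, so `v - k` falls linearly short of `m / 2` and `RM(m, v - k)` has
dimension exponentially smaller than `2 ^ m`. Words of weight about `2 ^ m` carry the factor `exp
(-Ω(2 ^ m))`, which beats their number. Summing over the `n + 1` dyadic scales gives the limit
(`sum_exp_lowWeight_le`). -/

theorem ENNReal.div_add_le_rpow_half (a b : ℝ≥0∞) : b / (a + b) ≤ (b / a) ^ (1 / 2 : ℝ) := by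
  rcases le_total (b / a) 1 with h | h
  · calc b / (a + b) ≤ b / a := ENNReal.div_le_div_left le_self_add _
      _ = (b / a) ^ (1 : ℝ) := (ENNReal.rpow_one _).symm
      _ ≤ _ := ENNReal.rpow_le_rpow_of_exponent_ge h (by norm_num)
  · calc b / (a + b) ≤ b / b := ENNReal.div_le_div_left le_add_self _
      _ ≤ 1 := ENNReal.div_self_le_one
      _ ≤ _ := ENNReal.one_le_rpow h (by norm_num)

theorem lintegral_pi_prod {ι : Type*} [Fintype ι] {Y : Type*} [MeasurableSpace Y]
    (μ : ι → Measure Y) [∀ i, IsProbabilityMeasure (μ i)] (g : ι → Y → ℝ≥0∞)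
    (hg : ∀ i, Measurable (g i)) :
    ∫⁻ y, ∏ i, g i (y i) ∂Measure.pi μ = ∏ i, ∫⁻ t, g i t ∂μ i := by
  have h := ProbabilityTheory.iIndepFun_pi (μ := μ) (X := g) (fun i => (hg i).aemeasurable)
  rw [ProbabilityTheory.lintegral_prod_eq_prod_lintegral_of_indepFun Finset.univ _ h
    (fun i => (hg i).comp (measurable_pi_apply i))]
  refine Finset.prod_congr rfl fun i _ => ?_
  exact (measurePreserving_eval μ i).lintegral_comp (hg i)

variable {Y : Type*} [MeasurableSpace Y] {W : ZMod 2 → Measure Y}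

theorem channel_absolutelyContinuous (W : ZMod 2 → Measure Y) (b : ZMod 2) : W b ≪ W 0 + W 1 := by
  have : b = 0 ∨ b = 1 := by revert b; decide
  rcases this with rfl | rfl
  · exact Measure.absolutelyContinuous_of_le (Measure.le_add_right le_rfl)
  · exact Measure.absolutelyContinuous_of_le (Measure.le_add_left le_rfl)

theorem measurable_channelDensity (b : ZMod 2) : Measurable (channelDensity W b) :=
  Measure.measurable_rnDeriv _ _

theorem measurable_wordDensity {ι : Type*} [Fintype ι] (x : ι → ZMod 2) :
    Measurable (wordDensity W x) := by
  unfold wordDensity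
  exact Finset.measurable_prod _ fun i _ =>
    (measurable_channelDensity (x i)).comp (measurable_pi_apply i)

theorem lintegral_sqrt_ratio_le (hW : IsBMS W) {z : ℝ} (hz : z ≠ 0) (hWz : bhattacharyya W = z)
    (b b' : ZMod 2) :
    ∫⁻ t, (channelDensity W b' t / channelDensity W b t) ^ (1 / 2 : ℝ) ∂W b ≤
      if b' ≠ b then ENNReal.ofReal z else 1 := by
  have := hW.isProbabilityMeasure
  split_ifs with h
  · have hint : Integrable (fun y => √((channelDensity W 0 y).toReal *
        (channelDensity W 1 y).toReal)) (W 0 + W 1) := by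
      -- A non-integrable function has integral `0` by convention, so `z ≠ 0` gives integrability.
      by_contra hc
      exact hz (hWz ▸ integral_undef hc)
    rw [← hWz, bhattacharyya, ofReal_integral_eq_lintegral_ofReal hint
      (ae_of_all _ fun _ => Real.sqrt_nonneg _)]
    -- After passing to the dominating measure, the integrand is `p_b * √(p_b' / p_b) = √(p_b *
    -- p_b')`.
    have key := lintegral_rnDeriv_mul (μ := W b) (ν := W 0 + W 1)
      (channel_absolutelyContinuous W b) (f := fun t => (channelDensity W b' t /
        channelDensity W b t) ^ (1 / 2 : ℝ))
      (((measurable_channelDensity b').div (measurable_channelDensity b)).pow_const _).aemeasurable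
    rw [← key]
    refine lintegral_mono_ae ?_
    filter_upwards [Measure.rnDeriv_lt_top (W 0) (W 0 + W 1),
      Measure.rnDeriv_lt_top (W 1) (W 0 + W 1)] with t h0 h1
    have hlt : ∀ c, channelDensity W c t < ∞ := by
      intro c
      have : c = 0 ∨ c = 1 := by revert c; decide
      rcases this with rfl | rfl
      · exact h0
      · exact h1
    have hprod : (channelDensity W 0 t).toReal * (channelDensity W 1 t).toReal =
        (channelDensity W b t).toReal * (channelDensity W b' t).toReal := by
      have : (b = 0 ∧ b' = 1) ∨ (b = 1 ∧ b' = 0) :=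
      (by decide : ∀ b b' : ZMod 2, b' ≠ b → (b = 0 ∧ b' = 1) ∨ (b = 1 ∧ b' = 0)) b b' h
      rcases this with ⟨rfl, rfl⟩ | ⟨rfl, rfl⟩
      · rfl
      · exact mul_comm _ _
    rw [hprod]
    change channelDensity W b t * _ ≤ _
    have ha := (hlt b).ne
    have hb := (hlt b').ne
    generalize channelDensity W b t = a at *
    generalize channelDensity W b' t = a' at *
    lift a to NNReal using ha
    lift a' to NNReal using hb
    rcases eq_or_ne a 0 with rfl | ha
    · simp
    rw [← ENNReal.coe_div ha, ← ENNReal.coe_rpow_of_nonneg _ (by norm_num), ← ENNReal.coe_mul,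
      ENNReal.ofReal]
    refine ENNReal.coe_le_coe.2 ?_
    rw [← NNReal.coe_le_coe, Real.coe_toNNReal _ (Real.sqrt_nonneg _)]
    simp only [NNReal.coe_mul, NNReal.coe_rpow, NNReal.coe_div, ENNReal.coe_toReal]
    refine Real.le_sqrt_of_sq_le ?_
    have ha' : (a : ℝ) ≠ 0 := by exact_mod_cast ha
    rw [← Real.sqrt_eq_rpow, mul_pow, Real.sq_sqrt (by positivity)]
    apply le_of_eq
    field_simp
  · push Not at h
    subst h
    calc _ ≤ ∫⁻ t, 1 ∂W b' := lintegral_mono fun t =>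
          (ENNReal.rpow_le_one ENNReal.div_self_le_one (by norm_num))
      _ = 1 := by simp

variable {ι : Type*} [Fintype ι]

/-- Dropping all but `x` and `x'` from the denominator leaves a two-word test, bounded by the square
root of the likelihood ratio. That factors over coordinates, each disagreement contributing `z`. -/
theorem lintegral_codePosterior_le (hW : IsBMS W) {z : ℝ} (hz : z ≠ 0)
    (hWz : bhattacharyya W = z) (C : Finset (ι → ZMod 2)) {x x' : ι → ZMod 2} (hx : x ∈ C)
    (hx' : x' ∈ C) (hne : x' ≠ x) :
    ∫⁻ y, codePosterior W C x' y ∂outputLaw W x ≤ ENNReal.ofReal z ^ hammingDist x' x := by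
  have := hW.isProbabilityMeasure
  calc ∫⁻ y, codePosterior W C x' y ∂outputLaw W x
      ≤ ∫⁻ y, ∏ i, (channelDensity W (x' i) (y i) / channelDensity W (x i) (y i)) ^ (1 / 2 : ℝ)
          ∂outputLaw W x := by
        refine lintegral_mono_ae ?_
        have hae : ∀ᵐ y ∂outputLaw W x, ∀ i, channelDensity W (x i) (y i) < ∞ :=
          eventually_all.2 fun i => (Measure.tendsto_eval_ae_ae (μ := fun i => W (x i)) (i := i)).eventually
            ((channel_absolutelyContinuous W (x i)).ae_le (Measure.rnDeriv_lt_top (W (x i)) (W 0 + W 1)))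
        filter_upwards [hae] with y hy
        calc codePosterior W C x' y
            ≤ wordDensity W x' y / (wordDensity W x y + wordDensity W x' y) := by
              refine ENNReal.div_le_div_left ?_ _
              rw [← Finset.sum_pair hne.symm (f := fun u => wordDensity W u y)]
              exact Finset.sum_le_sum_of_subset (by
                intro u; simp only [Finset.mem_insert, Finset.mem_singleton]
                rintro (rfl | rfl) <;> assumption)
          _ ≤ (wordDensity W x' y / wordDensity W x y) ^ (1 / 2 : ℝ) :=
              ENNReal.div_add_le_rpow_half _ _
          _ = _ := by
              rw [wordDensity, wordDensity,
                ← ENNReal.prod_div_distrib_of_ne_top fun i _ => (hy i).ne,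
                ENNReal.prod_rpow_of_nonneg (by norm_num)]
    _ = ∏ i, ∫⁻ t, (channelDensity W (x' i) t / channelDensity W (x i) t) ^ (1 / 2 : ℝ)
          ∂W (x i) := lintegral_pi_prod (fun i => W (x i)) _ fun i =>
        ((measurable_channelDensity _).div (measurable_channelDensity _)).pow_const _
    _ ≤ ∏ i, if x' i ≠ x i then ENNReal.ofReal z else 1 :=
        Finset.prod_le_prod' fun i _ => lintegral_sqrt_ratio_le hW hz hWz _ _
    _ = _ := by
        rw [Finset.prod_ite]; simp [hammingDist]

theorem hammingNorm_sub_eq_hammingDist (x y : ι → ZMod 2) :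
    hammingNorm (x - y) = hammingDist x y := by
  simp [hammingNorm, hammingDist, sub_ne_zero]

theorem randBlockMAPErrorWithin_le [DecidableEq ι] (hW : IsBMS W) {z : ℝ} (hz : z ≠ 0)
    (hWz : bhattacharyya W = z) (C : Finset (ι → ZMod 2)) (hC : ∀ x ∈ C, ∀ y ∈ C, x - y ∈ C)
    (r : ℝ) :
    randBlockMAPErrorWithin W C r ≤
      ∑ c ∈ C with c ≠ 0 ∧ (hammingNorm c : ℝ) ≤ r, ENNReal.ofReal z ^ hammingNorm c := by
  rw [randBlockMAPErrorWithin]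
  have hx : ∀ x ∈ C, ∫⁻ y, ∑ x' ∈ C with x' ≠ x ∧ (hammingDist x' x : ℝ) ≤ r,
      codePosterior W C x' y ∂outputLaw W x ≤
      ∑ c ∈ C with c ≠ 0 ∧ (hammingNorm c : ℝ) ≤ r, ENNReal.ofReal z ^ hammingNorm c := by
    intro x hx
    rw [lintegral_finsetSum (f := fun x' y => codePosterior W C x' y) _ fun x' _ =>
      (measurable_wordDensity x').div
        (Finset.measurable_fun_sum _ fun u _ => measurable_wordDensity u)]
    calc _ ≤ ∑ x' ∈ C with x' ≠ x ∧ (hammingDist x' x : ℝ) ≤ r,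
          ENNReal.ofReal z ^ hammingNorm (x' - x) := by
          refine Finset.sum_le_sum fun x' h => ?_
          rw [Finset.mem_filter] at h
          rw [hammingNorm_sub_eq_hammingDist]
          exact lintegral_codePosterior_le hW hz hWz C hx h.1 h.2.1
      _ = ∑ c ∈ ({x' ∈ C | x' ≠ x ∧ (hammingDist x' x : ℝ) ≤ r}.image fun x' => x' - x),
          ENNReal.ofReal z ^ hammingNorm c :=
          by rw [Finset.sum_image fun a _ b _ h => sub_left_injective h]
      _ ≤ _ := by
          refine Finset.sum_le_sum_of_subset fun c hc => ?_
          obtain ⟨x', h, rfl⟩ := Finset.mem_image.1 hc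
          rw [Finset.mem_filter] at h ⊢
          rw [hammingNorm_sub_eq_hammingDist]
          exact ⟨hC _ h.1 _ hx, sub_ne_zero.2 h.2.1, h.2.2⟩
  calc _ ≤ ∑ x ∈ C, (C.card : ℝ≥0∞)⁻¹ *
        ∑ c ∈ C with c ≠ 0 ∧ (hammingNorm c : ℝ) ≤ r, ENNReal.ofReal z ^ hammingNorm c :=
        Finset.sum_le_sum fun x h => mul_le_mul_right (hx x h) _
    _ = (C.card * (C.card : ℝ≥0∞)⁻¹) *
        ∑ c ∈ C with c ≠ 0 ∧ (hammingNorm c : ℝ) ≤ r, ENNReal.ofReal z ^ hammingNorm c := by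
        rw [Finset.sum_const, nsmul_eq_mul, mul_assoc]
    _ ≤ 1 * _ := mul_le_mul_left (ENNReal.mul_inv_le_one _) _
    _ = _ := one_mul _

end Channel

/-! ### Reed-Muller codes: substitution, partial sums, dimension -/

section Codes

open MvPolynomial

/-- The Reed-Muller code of order `v` in variables indexed by `σ`. -/
noncomputable def reedMullerOn (σ : Type*) (v : ℕ) : Submodule (ZMod 2) ((σ → ZMod 2) → ZMod 2) :=
  (restrictTotalDegree σ (ZMod 2) v).map (evalₗ (ZMod 2) σ)

variable {σ τ α : Type*}

theorem eval_mem_reedMullerOn {v : ℕ} {p : MvPolynomial σ (ZMod 2)} (hp : p.totalDegree ≤ v) :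
    (fun x => eval x p) ∈ reedMullerOn σ v :=
  ⟨p, (mem_restrictTotalDegree _ _ _).2 hp, rfl⟩

variable [Fintype σ] [Fintype α]

theorem ZMod.eq_one_of_ne_zero_two {a : ZMod 2} (h : a ≠ 0) : a = 1 := by
  revert a; decide

theorem MvPolynomial.eval_eq_sum_support_zmod_two (p : MvPolynomial σ (ZMod 2)) (x : σ → ZMod 2) :
    eval x p = ∑ d ∈ p.support, ∏ i, x i ^ d i := by
  rw [eval_eq']
  refine Finset.sum_congr rfl fun d hd => ?_
  rw [ZMod.eq_one_of_ne_zero_two (mem_support_iff.1 hd), one_mul]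

theorem exists_monomials_of_mem_reedMullerOn {v : ℕ} {f : (σ → ZMod 2) → ZMod 2}
    (hf : f ∈ reedMullerOn σ v) :
    ∃ s : Finset (σ →₀ ℕ), (∀ d ∈ s, ∑ i, d i ≤ v) ∧ ∀ x, f x = ∑ d ∈ s, ∏ i, x i ^ d i := by
  obtain ⟨p, hp, rfl⟩ := hf
  refine ⟨p.support, fun d hd => ?_, fun x => p.eval_eq_sum_support_zmod_two x⟩
  rw [← Finsupp.sum_fintype d (fun _ e => e) fun _ => rfl]
  exact (le_totalDegree hd).trans ((mem_restrictTotalDegree _ _ _).1 hp)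

theorem monomial_mem_reedMullerOn {v : ℕ} {d : σ → ℕ} (hd : ∑ i, d i ≤ v) :
    (fun x : σ → ZMod 2 => ∏ i, x i ^ d i) ∈ reedMullerOn σ v := by
  have := eval_mem_reedMullerOn (v := v) (p := ∏ i, (X i : MvPolynomial σ (ZMod 2)) ^ d i) <|
    (totalDegree_finsetProd _ _).trans <| (Finset.sum_le_sum fun i _ => by
      rw [totalDegree_X_pow]).trans hd
  simpa using this

theorem comp_mem_reedMullerOn {v : ℕ} {f : (σ → ZMod 2) → ZMod 2} (hf : f ∈ reedMullerOn σ v)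
    (q : σ → MvPolynomial τ (ZMod 2)) (hq : ∀ i, (q i).totalDegree ≤ 1) :
    (fun x => f fun i => eval x (q i)) ∈ reedMullerOn τ v := by
  obtain ⟨s, hs, hfs⟩ := exists_monomials_of_mem_reedMullerOn hf
  have := eval_mem_reedMullerOn (v := v) (p := ∑ d ∈ s, ∏ i, q i ^ d i) <| by
    refine totalDegree_finsetSum_le fun d hd => (totalDegree_finsetProd _ _).trans <|
      (Finset.sum_le_sum fun i _ => ?_).trans (hs d hd)
    exact (totalDegree_pow _ _).trans (by nlinarith [hq i])
  simpa [hfs] using this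

theorem sum_zmod_two_pow (e : ℕ) : ∑ t : ZMod 2, t ^ e = if e = 0 then 0 else 1 := by
  have : ∑ t : ZMod 2, t ^ e = 0 ^ e + 1 ^ e := Fin.sum_univ_two _
  rw [this]
  split_ifs with h
  · subst h; decide
  · simp [h]

/-- Summing a polynomial function over a block of variables lowers its degree by the size of the
block. -/
theorem sum_mem_reedMullerOn [Fintype τ] [DecidableEq α] {v : ℕ} {f : (α ⊕ τ → ZMod 2) → ZMod 2}
    (hf : f ∈ reedMullerOn (α ⊕ τ) v) :
    (fun c => ∑ a : α → ZMod 2, f (Sum.elim a c)) ∈ reedMullerOn τ (v - Fintype.card α) ∧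
      (v < Fintype.card α → ∀ c, ∑ a : α → ZMod 2, f (Sum.elim a c) = 0) := by
  obtain ⟨s, hs, hfs⟩ := exists_monomials_of_mem_reedMullerOn hf
  -- Since `∑ t, t ^ e` vanishes exactly when `e = 0`, a monomial survives only if it contains every
  -- variable of the block.
  have key : ∀ c : τ → ZMod 2, ∑ a : α → ZMod 2, f (Sum.elim a c) =
      ∑ d ∈ s, (∏ i : α, if d (Sum.inl i) = 0 then 0 else 1) * ∏ j, c j ^ d (Sum.inr j) := by
    intro c
    simp only [hfs, Fintype.prod_sum_type, Sum.elim_inl, Sum.elim_inr]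
    rw [Finset.sum_comm]
    refine Finset.sum_congr rfl fun d _ => ?_
    rw [← Finset.sum_mul]
    congr 1
    simp only [← sum_zmod_two_pow]
    rw [Finset.prod_univ_sum]
    simp
  have hcard : ∀ d ∈ s, (∀ i : α, d (Sum.inl i) ≠ 0) →
      Fintype.card α + ∑ j, d (Sum.inr j) ≤ v := by
    intro d hd h
    refine le_trans ?_ (hs d hd)
    rw [Fintype.sum_sum_type]
    gcongr
    calc Fintype.card α = ∑ _i : α, 1 := by simp
      _ ≤ _ := Finset.sum_le_sum fun i _ => Nat.one_le_iff_ne_zero.2 (h i)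
  constructor
  · simp only [key]
    have : (fun c : τ → ZMod 2 => ∑ d ∈ s,
        (∏ i : α, if d (Sum.inl i) = 0 then (0 : ZMod 2) else 1) * ∏ j, c j ^ d (Sum.inr j)) =
        ∑ d ∈ s, (∏ i : α, if d (Sum.inl i) = 0 then (0 : ZMod 2) else 1) •
          fun c : τ → ZMod 2 => ∏ j, c j ^ d (Sum.inr j) := by
      ext c; simp
    rw [this]
    refine Submodule.sum_mem _ fun d hd => ?_
    by_cases h : ∀ i : α, d (Sum.inl i) ≠ 0
    · exact Submodule.smul_mem _ _ (monomial_mem_reedMullerOn (by have := hcard d hd h; omega))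
    · push Not at h
      obtain ⟨i, hi⟩ := h
      rw [Finset.prod_eq_zero (Finset.mem_univ i) (by simp [hi]), zero_smul]
      exact Submodule.zero_mem _
  -- Truncated subtraction makes `v - card α` equal to `0` here, so vanishing has to be stated
  -- separately.
  · intro hv c
    rw [key]
    refine Finset.sum_eq_zero fun d hd => ?_
    have h : ¬∀ i : α, d (Sum.inl i) ≠ 0 := fun h => by have := hcard d hd h; omega
    push Not at h
    obtain ⟨i, hi⟩ := h
    rw [Finset.prod_eq_zero (Finset.mem_univ i) (by simp [hi]), zero_mul]

/-- The squarefree monomial with support `S`, as a function. -/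
def monomialFun (S : Finset σ) (x : σ → ZMod 2) : ZMod 2 := ∏ i ∈ S, x i

theorem prod_pow_eq_monomialFun (d : σ →₀ ℕ) :
    (fun x : σ → ZMod 2 => ∏ i, x i ^ d i) = monomialFun d.support := by
  ext x
  rw [monomialFun, ← Finset.prod_subset (Finset.subset_univ d.support)]
  · refine Finset.prod_congr rfl fun i hi => ?_
    have hi := Finsupp.mem_support_iff.1 hi
    by_cases h : x i = 0
    · simp [h, hi]
    · simp [ZMod.eq_one_of_ne_zero_two h]
  · intro i _ hi
    simp [Finsupp.notMem_support_iff.1 hi]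

theorem card_support_le_sum (d : σ →₀ ℕ) : d.support.card ≤ ∑ i, d i := by
  calc d.support.card = ∑ _i ∈ d.support, 1 := by simp
    _ ≤ ∑ i ∈ d.support, d i := Finset.sum_le_sum fun i hi =>
        Nat.one_le_iff_ne_zero.2 (Finsupp.mem_support_iff.1 hi)
    _ ≤ _ := Finset.sum_le_sum_of_subset (Finset.subset_univ _)

theorem finrank_reedMullerOn_le [DecidableEq σ] (v : ℕ) :
    Module.finrank (ZMod 2) (reedMullerOn σ v) ≤
      (Finset.univ.filter fun S : Finset σ => S.card ≤ v).card := by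
  classical
  set s := (Finset.univ.filter fun S : Finset σ => S.card ≤ v).image monomialFun
  have hle : reedMullerOn σ v ≤ Submodule.span (ZMod 2) (s : Set ((σ → ZMod 2) → ZMod 2)) := by
    intro f hf
    obtain ⟨t, ht, hft⟩ := exists_monomials_of_mem_reedMullerOn hf
    have : f = ∑ d ∈ t, monomialFun d.support := by
      ext x
      simp only [hft, Finset.sum_apply, ← prod_pow_eq_monomialFun]
    rw [this]
    refine Submodule.sum_mem _ fun d hd => Submodule.subset_span ?_
    simp only [s, Finset.coe_image, Finset.coe_filter]
    exact ⟨d.support, by simpa using (card_support_le_sum d).trans (ht d hd), rfl⟩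
  exact (Submodule.finrank_mono hle).trans
    ((finrank_span_finset_le_card s).trans Finset.card_image_le)

/-- Squarefree monomials span all functions, so those of degree above `v` make up what the code
misses. -/
theorem two_pow_le_finrank_reedMullerOn_add [DecidableEq σ] (v : ℕ) :
    2 ^ Fintype.card σ ≤ Module.finrank (ZMod 2) (reedMullerOn σ v) +
      (Finset.univ.filter fun S : Finset σ => v < S.card).card := by
  classical
  set s := (Finset.univ.filter fun S : Finset σ => v < S.card).image monomialFun
  have htop : (⊤ : Submodule (ZMod 2) ((σ → ZMod 2) → ZMod 2)) ≤
      reedMullerOn σ v ⊔ Submodule.span (ZMod 2) (s : Set ((σ → ZMod 2) → ZMod 2)) := by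
    intro f _
    have hf : f ∈ (restrictDegree σ (ZMod 2) (Fintype.card (ZMod 2) - 1)).map
        (evalₗ (ZMod 2) σ) := by rw [map_restrict_dom_evalₗ]; trivial
    obtain ⟨p, -, rfl⟩ := hf
    have : evalₗ (ZMod 2) σ p = ∑ d ∈ p.support, monomialFun d.support := by
      ext x
      simp only [Finset.sum_apply, ← prod_pow_eq_monomialFun]
      exact p.eval_eq_sum_support_zmod_two x
    rw [this]
    refine Submodule.sum_mem _ fun d _ => ?_
    rcases le_or_gt d.support.card v with h | h
    · refine Submodule.mem_sup_left ?_
      have := monomial_mem_reedMullerOn (σ := σ) (v := v)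
        (d := fun i => if i ∈ d.support then 1 else 0) (by
          rw [Finset.sum_ite_mem, Finset.univ_inter, Finset.sum_const, smul_eq_mul, mul_one]
          exact h)
      convert this using 2 with x
      simp only [monomialFun, pow_ite, pow_one, pow_zero]
      rw [Finset.prod_ite_mem, Finset.univ_inter]
    · refine Submodule.mem_sup_right (Submodule.subset_span ?_)
      simp only [s, Finset.coe_image, Finset.coe_filter]
      exact ⟨d.support, by simpa using h, rfl⟩
  have h := Submodule.finrank_mono htop
  rw [finrank_top, Module.finrank_fintype_fun_eq_card, Fintype.card_fun, ZMod.card] at h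
  exact h.trans ((Submodule.finrank_add_le_finrank_add_finrank _ _).trans
    (Nat.add_le_add_left ((finrank_span_finset_le_card s).trans Finset.card_image_le) _))

theorem natCard_reedMullerOn_le [DecidableEq σ] (v : ℕ) :
    Nat.card (reedMullerOn σ v) ≤
      2 ^ (Finset.univ.filter fun S : Finset σ => S.card ≤ v).card := by
  rw [Module.natCard_eq_pow_finrank (K := ZMod 2), Nat.card_zmod]
  exact Nat.pow_le_pow_right (by norm_num) (finrank_reedMullerOn_le v)

end Codes

/-! ### Derandomized majority vote -/

section Majority

/-- If each `x` is spoilt by at most a sixteenth of the elements of `B`, then some tuple of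
logarithmic length has a good majority for every `x`. -/
theorem exists_tuple_majority_good {X B : Type*} [Fintype X] [Fintype B] [Nonempty B]
    (bad : X → B → Prop) [∀ x, DecidablePred (bad x)]
    (h : ∀ x, 16 * (Finset.univ.filter (bad x)).card ≤ Fintype.card B) {t : ℕ}
    (ht : Fintype.card X < 2 ^ t) :
    ∃ b : Fin t → B, ∀ x, 2 * (Finset.univ.filter fun j => bad x (b j)).card < t := by
  by_contra! hcon
  -- Exponential weights: the product over `j` is at least `1` when at least half the votes are bad,
  -- while the mean of `φ x` is at most `4 / 16 + 1 / 4 = 1 / 2`. A union bound over `X` then costs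
  -- `card X / 2 ^ t < 1`.
  let φ : X → B → ℝ := fun x b => if bad x b then 4 else 4⁻¹
  have hφ : ∀ x b, 0 < φ x b := fun x b => by simp only [φ]; split_ifs <;> norm_num
  have hlow : ∀ b : Fin t → B, 1 ≤ ∑ x, ∏ j, φ x (b j) := by
    intro b
    obtain ⟨x, hx⟩ := hcon b
    refine le_trans ?_ (Finset.single_le_sum (f := fun x => ∏ j, φ x (b j))
      (fun y _ => Finset.prod_nonneg fun j _ => (hφ y (b j)).le) (Finset.mem_univ x))
    simp only [φ]
    rw [Finset.prod_ite, Finset.prod_const, Finset.prod_const, inv_pow, ← div_eq_mul_inv,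
      one_le_div (by positivity)]
    refine pow_le_pow_right₀ (by norm_num) ?_
    have := Finset.card_filter_add_card_filter_not (s := Finset.univ) fun j => bad x (b j)
    rw [Finset.card_univ, Fintype.card_fin] at this
    omega
  have hsum : ∀ x, ∑ b, φ x b ≤ (Fintype.card B : ℝ) / 2 := by
    intro x
    simp only [φ]
    rw [Finset.sum_ite, Finset.sum_const, Finset.sum_const, nsmul_eq_mul, nsmul_eq_mul]
    have h1 : (16 : ℝ) * (Finset.univ.filter (bad x)).card ≤ Fintype.card B := by
      exact_mod_cast h x
    have h2 : ((Finset.univ.filter fun b => ¬bad x b).card : ℝ) ≤ Fintype.card B := by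
      exact_mod_cast Finset.card_le_univ _
    linarith
  have hB : (0 : ℝ) < Fintype.card B := by exact_mod_cast Fintype.card_pos
  have h1 : (Fintype.card B : ℝ) ^ t ≤ Fintype.card X * ((Fintype.card B : ℝ) / 2) ^ t := by
    calc (Fintype.card B : ℝ) ^ t = ∑ _b : Fin t → B, (1 : ℝ) := by simp
      _ ≤ ∑ b : Fin t → B, ∑ x, ∏ j, φ x (b j) := Finset.sum_le_sum fun b _ => hlow b
      _ = ∑ x, ∏ _j : Fin t, ∑ b, φ x b := by
          rw [Finset.sum_comm]
          refine Finset.sum_congr rfl fun x _ => ?_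
          rw [Finset.prod_univ_sum]; simp
      _ ≤ ∑ _x : X, ((Fintype.card B : ℝ) / 2) ^ t := by
          refine Finset.sum_le_sum fun x _ => ?_
          rw [Finset.prod_const, Finset.card_univ, Fintype.card_fin]
          exact pow_le_pow_left₀ (Finset.sum_nonneg fun b _ => (hφ x b).le) (hsum x) _
      _ = _ := by simp
  rw [div_pow, mul_div_assoc', le_div_iff₀ (by positivity), mul_comm] at h1
  have h2 := le_of_mul_le_mul_right h1 (by positivity)
  have h3 : (Fintype.card X : ℝ) < 2 ^ t := by exact_mod_cast ht
  linarith

end Majority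

/-! ### Recovering a function of low weight from its folds -/

section Fold

variable {τ α : Type*} [Fintype τ] [Fintype α]

/-- For `u ≠ 0` the product `B *ᵥ u` with a uniform matrix `B` is uniform. -/
theorem two_pow_mul_card_mulVec {u : α → ZMod 2} [DecidableEq α] [DecidableEq τ] (hu : u ≠ 0)
    (P : (τ → ZMod 2) → Prop) [DecidablePred P] :
    2 ^ Fintype.card τ * (Finset.univ.filter fun B : Matrix τ α (ZMod 2) => P (B.mulVec u)).card =
      Fintype.card (Matrix τ α (ZMod 2)) * (Finset.univ.filter P).card := by
  let φ : Matrix τ α (ZMod 2) →+ (τ → ZMod 2) :=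
    { toFun := fun B => B.mulVec u
      map_zero' := Matrix.zero_mulVec u
      map_add' := fun A B => Matrix.add_mulVec A B u }
  have hsurj : ∀ c, c ∈ Set.range φ := by
    intro c
    obtain ⟨i, hi⟩ := Function.ne_iff.1 hu
    have hi1 : u i = 1 := ZMod.eq_one_of_ne_zero_two hi
    refine ⟨Matrix.of fun j i' => if i' = i then c j else 0, ?_⟩
    ext j
    change Matrix.mulVec _ u j = _
    simp [Matrix.mulVec, dotProduct, hi1]
  have hfib : ∀ c, (Finset.univ.filter fun B => φ B = c).card =
      (Finset.univ.filter fun B => φ B = 0).card := fun c =>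
    AddMonoidHom.card_fiber_eq_of_mem_range φ (hsurj c) (hsurj 0)
  have hall : Fintype.card (Matrix τ α (ZMod 2)) =
      2 ^ Fintype.card τ * (Finset.univ.filter fun B => φ B = 0).card := by
    rw [← Finset.card_univ, Finset.card_eq_sum_card_fiberwise (f := φ) (t := Finset.univ)
      (fun _ _ => Finset.mem_coe.2 (Finset.mem_univ _)), Finset.sum_congr rfl fun c _ => hfib c]
    simp
  have hP : (Finset.univ.filter fun B : Matrix τ α (ZMod 2) => P (B.mulVec u)).card =
      (Finset.univ.filter P).card * (Finset.univ.filter fun B => φ B = 0).card := by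
    rw [Finset.card_eq_sum_card_fiberwise (f := φ) (t := Finset.univ.filter P)
      (fun B hB => by
        simp only [Finset.coe_filter, Finset.mem_univ, true_and, Set.mem_ofPred_eq] at hB ⊢
        exact hB), ← smul_eq_mul, ← Finset.sum_const]
    refine Finset.sum_congr rfl fun c hc => ?_
    rw [← hfib c]
    congr 1
    ext B
    simp only [Finset.mem_filter, Finset.mem_univ, true_and] at hc ⊢
    exact ⟨fun h => h.2, fun h => ⟨by change P (φ B); rw [h]; exact hc, h⟩⟩
  rw [hP, hall]
  ring

/-- The sum of `f` over the graphs of the translates of the linear map `B`. -/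
def foldAlong [DecidableEq α] (f : (α ⊕ τ → ZMod 2) → ZMod 2) (B : Matrix τ α (ZMod 2))
    (c : τ → ZMod 2) : ZMod 2 :=
  ∑ a, f (Sum.elim a (c + B.mulVec a))

theorem hammingNorm_eq_sum_card [DecidableEq α] [DecidableEq τ]
    (f : (α ⊕ τ → ZMod 2) → ZMod 2) :
    hammingNorm f = ∑ a : α → ZMod 2,
      (Finset.univ.filter fun c : τ → ZMod 2 => f (Sum.elim a c) ≠ 0).card := by
  simp only [hammingNorm, Finset.card_filter]
  rw [← Fintype.sum_prod_type' (f := fun a c => if f (Sum.elim a c) ≠ 0 then 1 else 0)]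
  exact Fintype.sum_equiv (Equiv.sumArrowEquivProdArrow α τ (ZMod 2)) _ _ fun x => by
    simp [Equiv.sumArrowEquivProdArrow]

/-- For `a' ≠ a` the point `c + B (a + a')` is uniform, so the expected number of unwanted nonzero
terms in the fold is at most `wt f / 2 ^ card τ ≤ 1 / 16`. -/
theorem sixteen_mul_card_bad_le [DecidableEq α] [DecidableEq τ] (f : (α ⊕ τ → ZMod 2) → ZMod 2)
    (hf : 16 * hammingNorm f ≤ 2 ^ Fintype.card τ) (a : α → ZMod 2) (c : τ → ZMod 2) :
    16 * (Finset.univ.filter fun B : Matrix τ α (ZMod 2) =>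
      foldAlong f B (c + B.mulVec a) ≠ f (Sum.elim a c)).card ≤
      Fintype.card (Matrix τ α (ZMod 2)) := by
  set bad := Finset.univ.filter fun B : Matrix τ α (ZMod 2) =>
      foldAlong f B (c + B.mulVec a) ≠ f (Sum.elim a c) with hbad
  let badAt : (α → ZMod 2) → Finset (Matrix τ α (ZMod 2)) := fun a' =>
    Finset.univ.filter fun B => f (Sum.elim a' (c + B.mulVec (a + a'))) ≠ 0
  have hsub : bad ⊆ (Finset.univ.erase a).biUnion badAt := by
    intro B hB
    rw [hbad, Finset.mem_filter] at hB
    by_contra hc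
    refine hB.2 ?_
    -- The term at `a` is `f (a, c)`, because `B a + B a = 0`.
    rw [foldAlong, Finset.sum_eq_single a]
    · rw [add_assoc, ZModModule.add_self, add_zero]
    · intro a' _ ha'
      by_contra h0
      refine hc (Finset.mem_biUnion.2 ⟨a', Finset.mem_erase.2 ⟨ha', Finset.mem_univ _⟩, ?_⟩)
      simpa [badAt, Matrix.mulVec_add, add_assoc] using h0
    · simp
  have hAt : ∀ a' ∈ Finset.univ.erase a, 2 ^ Fintype.card τ * (badAt a').card =
      Fintype.card (Matrix τ α (ZMod 2)) *
        (Finset.univ.filter fun c : τ → ZMod 2 => f (Sum.elim a' c) ≠ 0).card := by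
    intro a' ha'
    have hu : a + a' ≠ 0 := fun h => (Finset.ne_of_mem_erase ha') (by
      rw [← ZModModule.neg_eq_self a']; exact (eq_neg_of_add_eq_zero_left h).symm)
    rw [two_pow_mul_card_mulVec hu fun w => f (Sum.elim a' (c + w)) ≠ 0]
    congr 1
    exact Finset.card_equiv (Equiv.addLeft c) (by simp)
  have h1 : 2 ^ Fintype.card τ * bad.card ≤
      Fintype.card (Matrix τ α (ZMod 2)) * hammingNorm f := by
    calc 2 ^ Fintype.card τ * bad.card
        ≤ 2 ^ Fintype.card τ * ∑ a' ∈ Finset.univ.erase a, (badAt a').card :=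
          Nat.mul_le_mul_left _ ((Finset.card_le_card hsub).trans Finset.card_biUnion_le)
      _ = Fintype.card (Matrix τ α (ZMod 2)) * ∑ a' ∈ Finset.univ.erase a,
          (Finset.univ.filter fun c : τ → ZMod 2 => f (Sum.elim a' c) ≠ 0).card := by
          rw [Finset.mul_sum, Finset.mul_sum]
          exact Finset.sum_congr rfl hAt
      _ ≤ _ := by
          rw [hammingNorm_eq_sum_card]
          exact Nat.mul_le_mul_left _ (Finset.sum_le_sum_of_subset (Finset.erase_subset _ _))
  refine le_of_mul_le_mul_left ?_ (Nat.two_pow_pos (Fintype.card τ))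
  calc 2 ^ Fintype.card τ * (16 * bad.card) = 16 * (2 ^ Fintype.card τ * bad.card) := by ring
    _ ≤ 16 * (Fintype.card (Matrix τ α (ZMod 2)) * hammingNorm f) := Nat.mul_le_mul_left _ h1
    _ = Fintype.card (Matrix τ α (ZMod 2)) * (16 * hammingNorm f) := by ring
    _ ≤ Fintype.card (Matrix τ α (ZMod 2)) * 2 ^ Fintype.card τ := Nat.mul_le_mul_left _ hf
    _ = _ := mul_comm _ _

/-- The majority vote of the functions `(a, c) ↦ g j (c + B j *ᵥ a)`. -/
def majorityDecode {t : ℕ} (Bg : Fin t → Matrix τ α (ZMod 2) × ((τ → ZMod 2) → ZMod 2))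
    (x : α ⊕ τ → ZMod 2) : ZMod 2 :=
  if t < 2 * (Finset.univ.filter fun j =>
    (Bg j).2 ((x ∘ Sum.inr) + (Bg j).1.mulVec (x ∘ Sum.inl)) ≠ 0).card then 1 else 0

/-- A function of low weight is a majority vote of its folds along a few linear maps. -/
theorem exists_majorityDecode_eq [DecidableEq α] [DecidableEq τ]
    (f : (α ⊕ τ → ZMod 2) → ZMod 2) (hf : 16 * hammingNorm f ≤ 2 ^ Fintype.card τ) {t : ℕ}
    (ht : Fintype.card α + Fintype.card τ < t) :
    ∃ B : Fin t → Matrix τ α (ZMod 2), majorityDecode (fun j => (B j, foldAlong f (B j))) = f := by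
  obtain ⟨B, hB⟩ := exists_tuple_majority_good (X := α ⊕ τ → ZMod 2) (B := Matrix τ α (ZMod 2))
    (fun x B => foldAlong f B ((x ∘ Sum.inr) + B.mulVec (x ∘ Sum.inl)) ≠ f x)
    (fun x => by
      have := sixteen_mul_card_bad_le f hf (x ∘ Sum.inl) (x ∘ Sum.inr)
      rwa [Sum.elim_comp_inl_inr] at this) (t := t) (by
      rw [Fintype.card_fun, ZMod.card, Fintype.card_sum]
      exact Nat.pow_lt_pow_right (by norm_num) ht)
  refine ⟨B, funext fun x => ?_⟩
  have hx := hB x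
  rw [majorityDecode]
  have hcompl := Finset.card_filter_add_card_filter_not (s := Finset.univ) fun j =>
    foldAlong f (B j) ((x ∘ Sum.inr) + (B j).mulVec (x ∘ Sum.inl)) ≠ f x
  rw [Finset.card_univ, Fintype.card_fin] at hcompl
  by_cases h0 : f x = 0
  · rw [h0] at hx ⊢
    exact if_neg (by simpa using hx.le)
  · have h1 : f x = 1 := ZMod.eq_one_of_ne_zero_two h0
    rw [h1]
    refine if_pos ?_
    have : (Finset.univ.filter fun j => ¬foldAlong f (B j)
        ((x ∘ Sum.inr) + (B j).mulVec (x ∘ Sum.inl)) ≠ f x).card ≤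
        (Finset.univ.filter fun j => foldAlong f (B j)
          ((x ∘ Sum.inr) + (B j).mulVec (x ∘ Sum.inl)) ≠ 0).card := by
      refine Finset.card_le_card fun j hj => ?_
      simp only [Finset.mem_filter, Finset.mem_univ, true_and, not_not] at hj ⊢
      rw [hj]; exact h0
    change t < 2 * (Finset.univ.filter fun j => foldAlong f (B j)
          ((x ∘ Sum.inr) + (B j).mulVec (x ∘ Sum.inl)) ≠ 0).card
    omega

end Fold

/-! ### Counting codewords of low weight -/

section Counting

open MvPolynomial

variable {σ τ α : Type*} [Fintype σ] [Fintype τ] [Fintype α] [DecidableEq α] [DecidableEq τ]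

omit [DecidableEq τ] in
-- The shear `(a, c) ↦ (a, c + B a)` is linear and keeps the degree; the fold then sums out the
-- block `α`.
theorem foldAlong_mem {v : ℕ} {f : (α ⊕ τ → ZMod 2) → ZMod 2} (hf : f ∈ reedMullerOn (α ⊕ τ) v)
    (B : Matrix τ α (ZMod 2)) :
    foldAlong f B ∈ reedMullerOn τ (v - Fintype.card α) ∧
      (v < Fintype.card α → ∀ c, foldAlong f B c = 0) := by
  let q : α ⊕ τ → MvPolynomial (α ⊕ τ) (ZMod 2) := Sum.elim (fun i => X (Sum.inl i))
    fun j => X (Sum.inr j) + ∑ i, C (B j i) * X (Sum.inl i)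
  have hq : ∀ i, (q i).totalDegree ≤ 1 := by
    rintro (i | j)
    · simp [q]
    · refine (totalDegree_add _ _).trans (max_le (by simp) (totalDegree_finsetSum_le fun i _ => ?_))
      exact (totalDegree_mul _ _).trans (by simp)
  have heq : ∀ a c, f (Sum.elim a (c + B.mulVec a)) = f fun i => eval (Sum.elim a c) (q i) := by
    intro a c
    congr 1
    ext (i | j)
    · simp [q]
    · simp [q, Matrix.mulVec, dotProduct]
  have h := sum_mem_reedMullerOn (comp_mem_reedMullerOn hf q hq)
  have : foldAlong f B = fun c => ∑ a, f fun i => eval (Sum.elim a c) (q i) := by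
    ext c
    exact Finset.sum_congr rfl fun a _ => heq a c
  rw [this]
  exact h

/-- All folds vanish, hence so does their majority vote. This weak minimum distance bound keeps the
scale `m` from being too small. -/
theorem eq_zero_of_mem_reedMullerOn_of_lowWeight {v : ℕ} {f : (α ⊕ τ → ZMod 2) → ZMod 2}
    (hf : f ∈ reedMullerOn (α ⊕ τ) v) (hw : 16 * hammingNorm f ≤ 2 ^ Fintype.card τ)
    (hv : v < Fintype.card α) : f = 0 := by
  obtain ⟨B, hB⟩ := exists_majorityDecode_eq f hw (Nat.lt_succ_self _)
  rw [← hB]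
  ext x
  simp [majorityDecode, (foldAlong_mem hf _).2 hv]

/-- A word is encoded by `t` pairs of a matrix and a fold, and majority decoding inverts the
encoding. -/
theorem ncard_lowWeight_reedMullerOn_le (v : ℕ) {t : ℕ}
    (ht : Fintype.card α + Fintype.card τ < t) :
    {f | f ∈ reedMullerOn (α ⊕ τ) v ∧ 16 * hammingNorm f ≤ 2 ^ Fintype.card τ}.ncard ≤
      (2 ^ (Fintype.card α * Fintype.card τ) *
        2 ^ (Finset.univ.filter fun S : Finset τ => S.card ≤ v - Fintype.card α).card) ^ t := by
  let Φ : (Fin t → Matrix τ α (ZMod 2) × reedMullerOn τ (v - Fintype.card α)) →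
      (α ⊕ τ → ZMod 2) → ZMod 2 := fun Bg => majorityDecode fun j => ((Bg j).1, (Bg j).2.1)
  have hsub : {f | f ∈ reedMullerOn (α ⊕ τ) v ∧ 16 * hammingNorm f ≤ 2 ^ Fintype.card τ} ⊆
      Set.range Φ := by
    rintro f ⟨hf, hw⟩
    obtain ⟨B, hB⟩ := exists_majorityDecode_eq f hw ht
    exact ⟨fun j => (B j, ⟨_, (foldAlong_mem hf (B j)).1⟩), hB⟩
  have : Finite (Matrix τ α (ZMod 2)) := inferInstanceAs (Finite (τ → α → ZMod 2))
  calc _ ≤ (Set.range Φ).ncard := Set.ncard_le_ncard hsub (Set.toFinite _)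
    _ ≤ Nat.card (Fin t → Matrix τ α (ZMod 2) × reedMullerOn τ (v - Fintype.card α)) :=
        Finite.card_range_le Φ
    _ = (Nat.card (Matrix τ α (ZMod 2)) * Nat.card (reedMullerOn τ (v - Fintype.card α))) ^ t := by
        rw [Nat.card_fun, Nat.card_prod]; simp
    _ ≤ _ := by
        refine Nat.pow_le_pow_left (Nat.mul_le_mul (le_of_eq ?_) (natCard_reedMullerOn_le _)) _
        change Nat.card (τ → α → ZMod 2) = _
        simp [Nat.card_eq_fintype_card, ← pow_mul]

theorem comp_reindex_mem {ρ : Type*} (e : ρ ≃ σ) {v : ℕ} {f : (σ → ZMod 2) → ZMod 2}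
    (hf : f ∈ reedMullerOn σ v) : (fun y => f (y ∘ e.symm)) ∈ reedMullerOn ρ v := by
  have := comp_mem_reedMullerOn hf (fun i => (X (e.symm i) : MvPolynomial ρ (ZMod 2)))
    fun i => by simp
  simpa [Function.comp_def] using this

theorem hammingNorm_comp_reindex [DecidableEq σ] {ρ : Type*} [Fintype ρ] [DecidableEq ρ]
    (e : ρ ≃ σ) (f : (σ → ZMod 2) → ZMod 2) :
    hammingNorm (fun y : ρ → ZMod 2 => f (y ∘ e.symm)) = hammingNorm f := by
  refine Finset.card_equiv (e.arrowCongr (Equiv.refl (ZMod 2))) fun y => ?_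
  simp [Equiv.arrowCongr]

theorem eq_zero_of_mem_reedMuller_of_lowWeight {k m n v : ℕ} (hn : k + m = n)
    {f : (Fin n → ZMod 2) → ZMod 2} (hf : f ∈ reedMuller n v)
    (hw : 16 * hammingNorm f ≤ 2 ^ m) (hv : v < k) : f = 0 := by
  subst hn
  have h := eq_zero_of_mem_reedMullerOn_of_lowWeight (comp_reindex_mem finSumFinEquiv hf)
    (by rw [hammingNorm_comp_reindex]; simpa using hw) (by simpa using hv)
  ext x
  have := congrFun h (x ∘ finSumFinEquiv)
  simpa [Function.comp_assoc] using this

theorem card_lowWeight_reedMuller_le {k m n : ℕ} (hn : k + m = n) (v : ℕ) :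
    {f ∈ reedMullerCodewords n v | 16 * hammingNorm f ≤ 2 ^ m}.card ≤
      (2 ^ (k * m) * 2 ^ (Finset.univ.filter fun S : Finset (Fin m) => S.card ≤ v - k).card) ^
        (n + 1) := by
  subst hn
  have h := ncard_lowWeight_reedMullerOn_le (α := Fin k) (τ := Fin m) v (t := k + m + 1) (by simp)
  simp only [Fintype.card_fin] at h
  refine le_trans ?_ h
  rw [← Set.ncard_coe_finset]
  refine Set.ncard_le_ncard_of_injOn
    (fun f (y : Fin k ⊕ Fin m → ZMod 2) => f (y ∘ finSumFinEquiv.symm)) (fun f hf => ?_)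
    (fun f _ g _ hfg => ?_) (Set.toFinite _)
  · simp only [Finset.coe_filter, reedMullerCodewords, Set.Finite.mem_toFinset, SetLike.mem_coe,
      Set.mem_ofPred_eq] at hf ⊢
    exact ⟨comp_reindex_mem finSumFinEquiv hf.1, by rw [hammingNorm_comp_reindex]; exact hf.2⟩
  · ext x
    have := congrFun hfg (x ∘ finSumFinEquiv)
    simpa [Function.comp_assoc] using this

end Counting

/-! ### Chernoff bound for subset sizes -/

section Tail

open Real

theorem sum_exp_card_finset {σ : Type*} [Fintype σ] (s : ℝ) :
    ∑ S : Finset σ, exp (s * (2 * S.card - Fintype.card σ)) = (2 * cosh s) ^ Fintype.card σ := by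
  rw [cosh_eq, mul_div_cancel₀ _ (two_ne_zero), ← Fintype.sum_pow_mul_eq_add_pow]
  refine Finset.sum_congr rfl fun S _ => ?_
  rw [← exp_nat_mul, ← exp_nat_mul, ← exp_add, Nat.cast_sub S.card_le_univ]
  congr 1
  ring

/-- The Chernoff bound for the size of a uniformly random subset. -/
theorem card_filter_le_exp {σ : Type*} [Fintype σ] (s y : ℝ) (p : Finset σ → Prop)
    [DecidablePred p] (hp : ∀ S, p S → y ≤ s * (2 * S.card - Fintype.card σ)) :
    ((Finset.univ.filter p).card : ℝ) ≤
      2 ^ Fintype.card σ * exp (Fintype.card σ * (s ^ 2 / 2) - y) := by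
  have h1 : (Finset.univ.filter p).card * exp y ≤ (2 * cosh s) ^ Fintype.card σ := by
    rw [← sum_exp_card_finset, ← nsmul_eq_mul, ← Finset.sum_const]
    calc _ ≤ ∑ S ∈ Finset.univ.filter p, exp (s * (2 * S.card - Fintype.card σ)) :=
          Finset.sum_le_sum fun S hS => exp_le_exp.2 (hp S (Finset.mem_filter.1 hS).2)
      _ ≤ _ := Finset.sum_le_sum_of_subset_of_nonneg (Finset.filter_subset _ _)
          fun _ _ _ => (exp_pos _).le
  rw [exp_sub, mul_div_assoc', le_div_iff₀ (exp_pos _)]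
  refine h1.trans ?_
  rw [mul_pow, exp_nat_mul]
  gcongr
  exact cosh_le_exp_half_sq s

end Tail

/-! ### From rate to degree -/

section Rate

open Real

theorem one_sub_exp_le_reedMullerRate {n v : ℕ} {δ : ℝ} (hδ : 0 < δ)
    (hv : (1 + δ) * n < 2 * v) : 1 - exp (-(δ ^ 2 / 2 * n)) ≤ reedMullerRate n v := by
  have h1 := two_pow_le_finrank_reedMullerOn_add (σ := Fin n) v
  have h2 := card_filter_le_exp (σ := Fin n) δ (δ ^ 2 * n) (fun S => v < S.card) fun S hS => by
    have : (v : ℝ) < S.card := by exact_mod_cast hS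
    rw [Fintype.card_fin]
    nlinarith
  rw [Fintype.card_fin] at h1 h2
  rw [reedMullerRate, le_div_iff₀ (by positivity)]
  have h3 : (2 : ℝ) ^ n ≤ Module.finrank (ZMod 2) (reedMuller n v) +
      (Finset.univ.filter fun S : Finset (Fin n) => v < S.card).card := by exact_mod_cast h1
  have h4 : (n : ℝ) * (δ ^ 2 / 2) - δ ^ 2 * n = -(δ ^ 2 / 2 * n) := by ring
  rw [h4] at h2
  linarith

/-- A larger degree would push the rate above `1 - exp (-(δ ^ 2 / 2 * n))`, which tends to `1 > R`.
-/
theorem eventually_two_mul_degree_le {n v : ℕ → ℕ} (hn : Tendsto n atTop atTop) {R : ℝ} (hR : R < 1)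
    (hrate : Tendsto (fun k => reedMullerRate (n k) (v k)) atTop (𝓝 R)) {δ : ℝ} (hδ : 0 < δ) :
    ∀ᶠ k in atTop, 2 * (v k : ℝ) ≤ (1 + δ) * n k := by
  have hexp : Tendsto (fun k => 1 - exp (-(δ ^ 2 / 2 * n k))) atTop (𝓝 (1 - 0)) :=
    ((tendsto_exp_neg_atTop_nhds_zero.comp
      (Tendsto.const_mul_atTop (by positivity) tendsto_natCast_atTop_atTop)).comp hn).const_sub 1
  rw [sub_zero] at hexp
  filter_upwards [hrate.eventually_lt hexp hR] with k hk
  by_contra hc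
  exact absurd (one_sub_exp_le_reedMullerRate hδ (not_le.1 hc)) (not_le.2 hk)

end Rate

/-! ### Low-weight part of the weight enumerator -/

section WeightEnumerator

open Real

/-- The low-weight part of dimension `m` of the weight enumerator of `RM(n, v)`. -/
theorem card_lowWeight_mul_exp_le {n v m : ℕ} {L β δ : ℝ} (hL : 0 < L) (hβ : 0 < β)
    (hδβ : δ ≤ β / 4) (hδ : δ ≤ 1 / 2) (hv : 2 * (v : ℝ) ≤ (1 + δ) * n) (hm : m ≤ n)
    (hmv : n - m ≤ v) (hmβ : (m : ℝ) ≤ 5 + n * (1 - β)) (h5 : 5 ≤ β * n / 4)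
    (hc : (n + 1) * exp (-(β ^ 2 / 8 * n)) ≤ L / 128)
    (hpoly : ((n : ℝ) + 1) * n ^ 2 ≤ L / 128 * 2 ^ ((n : ℝ) / 4)) :
    ({f ∈ reedMullerCodewords n v | 16 * hammingNorm f ≤ 2 ^ m}.card : ℝ) *
      exp (-(L * (2 ^ m / 32))) ≤ exp (-(L / 64 * 2 ^ ((n : ℝ) / 4))) := by
  obtain ⟨k, hk⟩ : ∃ k, k + m = n := ⟨n - m, Nat.sub_add_cancel hm⟩
  have hkv : k ≤ v := by omega
  have hkR : (k : ℝ) + m = n := by exact_mod_cast hk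
  have hkvR : (k : ℝ) ≤ v := by exact_mod_cast hkv
  have hk0 : (0 : ℝ) ≤ k := Nat.cast_nonneg k
  have hm0 : (0 : ℝ) ≤ m := Nat.cast_nonneg m
  have hn0 : (0 : ℝ) ≤ n := Nat.cast_nonneg n
  -- From `k ≤ v` and `δ ≤ 1 / 2` one gets `k ≤ 3 n / 4`, so `m ≥ n / 4`.
  have hpow : (2 : ℝ) ^ ((n : ℝ) / 4) ≤ 2 ^ m := by
    rw [← rpow_natCast]
    exact rpow_le_rpow_of_exponent_le one_le_two (by nlinarith)
  set D := (Finset.univ.filter fun S : Finset (Fin m) => S.card ≤ v - k).card with hD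
  have hDle : (D : ℝ) ≤ 2 ^ m * exp (-(β ^ 2 / 8 * n)) := by
    have h := card_filter_le_exp (σ := Fin m) (-(β / 2)) (β ^ 2 / 4 * n)
      (fun S => S.card ≤ v - k) fun S hS => by
        have hS' : (S.card : ℝ) ≤ v - k := by
          rw [← Nat.cast_sub hkv]; exact_mod_cast hS
        rw [Fintype.card_fin]
        -- Here `2 (v - k) - m ≤ δ n - k`, with `k ≥ β n - 5 ≥ 3 β n / 4` and `δ ≤ β / 4`.
        have h1 : (2 : ℝ) * S.card - m ≤ -(β / 2 * n) := by nlinarith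
        nlinarith
    rw [Fintype.card_fin] at h
    refine h.trans ?_
    gcongr
    have : (m : ℝ) ≤ n := by linarith
    nlinarith [sq_nonneg β]
  have hcard : ({f ∈ reedMullerCodewords n v | 16 * hammingNorm f ≤ 2 ^ m}.card : ℝ) ≤
      exp ((n + 1) * (k * m + D)) := by
    calc _ ≤ (((2 ^ (k * m) * 2 ^ D) ^ (n + 1) : ℕ) : ℝ) := by
          exact_mod_cast card_lowWeight_reedMuller_le hk v
      _ = (2 : ℝ) ^ ((k * m + D) * (n + 1)) := by push_cast; rw [← pow_add, ← pow_mul]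
      _ ≤ exp 1 ^ ((k * m + D) * (n + 1)) := by
          gcongr; linarith [add_one_le_exp (1 : ℝ)]
      _ = _ := by rw [← exp_nat_mul]; congr 1; push_cast; ring
  calc _ ≤ exp ((n + 1) * (k * m + D)) * exp (-(L * (2 ^ m / 32))) := by gcongr
    _ = exp ((n + 1) * (k * m + D) - L * (2 ^ m / 32)) := by rw [← exp_add]; rfl
    _ ≤ _ := by
        refine exp_le_exp.2 ?_
        -- Matrices and folds each use at most `L / 128` of the available `L / 32`, leaving `L /
        -- 64`.
        have h1 : ((n : ℝ) + 1) * (k * m) ≤ L / 128 * 2 ^ m := by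
          calc ((n : ℝ) + 1) * (k * m) ≤ (n + 1) * n ^ 2 := by gcongr; nlinarith
            _ ≤ _ := hpoly.trans (by gcongr)
        have h2 : ((n : ℝ) + 1) * D ≤ L / 128 * 2 ^ m := by
          calc ((n : ℝ) + 1) * D ≤ (n + 1) * (2 ^ m * exp (-(β ^ 2 / 8 * n))) := by gcongr
            _ = ((n + 1) * exp (-(β ^ 2 / 8 * n))) * 2 ^ m := by ring
            _ ≤ _ := by gcongr
        have h3 : L / 64 * 2 ^ ((n : ℝ) / 4) ≤ L / 64 * 2 ^ m := by gcongr
        linarith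

/-- The scale must be large enough for majority decoding, yet within a constant factor of the weight
so that `z ^ w` stays small. -/
theorem exists_dyadic_weight {w : ℕ} (hw : 0 < w) :
    ∃ m, 16 * w ≤ 2 ^ m ∧ 2 ^ m < 32 * w := by
  refine ⟨Nat.clog 2 (16 * w), Nat.le_pow_clog one_lt_two _, ?_⟩
  have h := Nat.pow_pred_clog_lt_self one_lt_two (x := 16 * w) (by omega)
  have hpos : 0 < Nat.clog 2 (16 * w) := Nat.clog_pos one_lt_two (by omega)
  obtain ⟨j, hj⟩ := Nat.exists_eq_succ_of_ne_zero hpos.ne'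
  rw [hj] at h ⊢
  rw [Nat.pred_succ] at h
  rw [pow_succ]
  omega

theorem sum_exp_lowWeight_le {n v : ℕ} {L β δ : ℝ} (hL : 0 < L) (hβ : 0 < β)
    (hδβ : δ ≤ β / 4) (hδ : δ ≤ 1 / 2) (hv : 2 * (v : ℝ) ≤ (1 + δ) * n) (h5 : 5 ≤ β * n / 4)
    (hc : (n + 1) * exp (-(β ^ 2 / 8 * n)) ≤ L / 128)
    (hpoly : ((n : ℝ) + 1) * n ^ 2 ≤ L / 128 * 2 ^ ((n : ℝ) / 4)) :
    ∑ c ∈ reedMullerCodewords n v with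
        c ≠ 0 ∧ (hammingNorm c : ℝ) ≤ (2 : ℝ) ^ ((n : ℝ) * (1 - β)), exp (-L) ^ hammingNorm c ≤
      (n + 1) * exp (-(L / 64 * 2 ^ ((n : ℝ) / 4))) := by
  set low : ℕ → Finset ((Fin n → ZMod 2) → ZMod 2) := fun m =>
    {f ∈ reedMullerCodewords n v | 16 * hammingNorm f ≤ 2 ^ m} with hlow
  -- The first condition holds at the scale of any nonzero codeword by the vanishing result; the
  -- second is `2 ^ m < 32 * 2 ^ (n (1 - β))`, with `32 = 2 ^ 5`.
  set I := {m ∈ Finset.range (n + 1) | n - m ≤ v ∧ (m : ℝ) ≤ 5 + n * (1 - β)} with hI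
  have hn0 : (0 : ℝ) ≤ n := Nat.cast_nonneg n
  have hmem : ∀ c ∈ {c ∈ reedMullerCodewords n v |
      c ≠ 0 ∧ (hammingNorm c : ℝ) ≤ (2 : ℝ) ^ ((n : ℝ) * (1 - β))},
      ∃ m ∈ I, c ∈ low m ∧ exp (-L) ^ hammingNorm c ≤ exp (-(L * (2 ^ m / 32))) := by
    intro c hc
    obtain ⟨hcC, hc0, hcw⟩ := Finset.mem_filter.1 hc
    obtain ⟨m, hm1, hm2⟩ := exists_dyadic_weight (hammingNorm_pos_iff.2 hc0)
    have hm2R : (2 : ℝ) ^ m < 32 * hammingNorm c := by exact_mod_cast hm2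
    have hmβ : (m : ℝ) ≤ 5 + n * (1 - β) := by
      have h : (2 : ℝ) ^ (m : ℝ) ≤ 2 ^ (5 + n * (1 - β)) := by
        rw [rpow_natCast, rpow_add two_pos]
        norm_num
        linarith
      exact (rpow_le_rpow_left_iff one_lt_two).1 h
    have hmn : m ≤ n := by
      have : (m : ℝ) ≤ n := by nlinarith
      exact_mod_cast this
    refine ⟨m, ?_, Finset.mem_filter.2 ⟨hcC, hm1⟩, ?_⟩
    · refine Finset.mem_filter.2 ⟨Finset.mem_range.2 (by omega), ?_, hmβ⟩
      by_contra hlt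
      refine hc0 (eq_zero_of_mem_reedMuller_of_lowWeight (Nat.sub_add_cancel hmn) ?_ hm1
        (not_le.1 hlt))
      simpa [reedMullerCodewords] using hcC
    · rw [← exp_nat_mul]
      refine exp_le_exp.2 ?_
      nlinarith
  -- `low m` also contains words much lighter than `2 ^ m / 32`; the indicator keeps only those
  -- whose term obeys the bound for scale `m`.
  calc _ ≤ ∑ c ∈ reedMullerCodewords n v, ∑ m ∈ I,
          if c ∈ low m ∧ exp (-L) ^ hammingNorm c ≤ exp (-(L * (2 ^ m / 32)))
            then exp (-L) ^ hammingNorm c else 0 := by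
        refine (Finset.sum_le_sum fun c hc => ?_).trans (Finset.sum_le_sum_of_subset_of_nonneg
          (Finset.filter_subset _ _) fun _ _ _ => Finset.sum_nonneg fun _ _ => by positivity)
        obtain ⟨m, hm, h⟩ := hmem c hc
        refine le_trans (le_of_eq (if_pos h).symm) (Finset.single_le_sum (f := fun m =>
          if c ∈ low m ∧ exp (-L) ^ hammingNorm c ≤ exp (-(L * (2 ^ m / 32)))
            then exp (-L) ^ hammingNorm c else 0) (fun _ _ => by positivity) hm)
    _ = ∑ m ∈ I, ∑ c ∈ low m with
          exp (-L) ^ hammingNorm c ≤ exp (-(L * (2 ^ m / 32))), exp (-L) ^ hammingNorm c := by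
        rw [Finset.sum_comm]
        refine Finset.sum_congr rfl fun m _ => ?_
        rw [← Finset.sum_filter]
        refine Finset.sum_congr ?_ fun _ _ => rfl
        ext c
        simp only [hlow, Finset.mem_filter]
        tauto
    _ ≤ ∑ m ∈ I, exp (-(L / 64 * 2 ^ ((n : ℝ) / 4))) := by
        refine Finset.sum_le_sum fun m hm => ?_
        obtain ⟨hm1, hm2, hm3⟩ := Finset.mem_filter.1 hm
        refine le_trans ?_ (card_lowWeight_mul_exp_le hL hβ hδβ hδ hv
          (Nat.lt_succ_iff.1 (Finset.mem_range.1 hm1)) hm2 hm3 h5 hc hpoly)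
        calc _ ≤ ∑ c ∈ low m with exp (-L) ^ hammingNorm c ≤ exp (-(L * (2 ^ m / 32))),
              exp (-(L * (2 ^ m / 32))) :=
              Finset.sum_le_sum fun c hc => (Finset.mem_filter.1 hc).2
          _ ≤ _ := by
              rw [Finset.sum_const, nsmul_eq_mul]
              gcongr
              exact Finset.filter_subset _ _
    _ ≤ _ := by
        rw [Finset.sum_const, nsmul_eq_mul]
        gcongr
        have : I.card ≤ n + 1 := (Finset.card_filter_le _ _).trans (by simp)
        exact_mod_cast this

end WeightEnumerator

/-! ### Elementary limits -/

section Limits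

open Real

theorem tendsto_pow_mul_exp_neg_mul (j : ℕ) {c : ℝ} (hc : 0 < c) :
    Tendsto (fun n : ℕ => (n : ℝ) ^ j * exp (-(c * n))) atTop (𝓝 0) := by
  have h := (tendsto_pow_mul_exp_neg_atTop_nhds_zero j).comp
    (Tendsto.const_mul_atTop hc tendsto_natCast_atTop_atTop)
  have h2 := h.const_mul ((c ^ j)⁻¹)
  rw [mul_zero] at h2
  refine h2.congr fun n => ?_
  simp only [Function.comp, mul_pow]
  field_simp

theorem tendsto_succ_mul_exp_neg_mul {c : ℝ} (hc : 0 < c) :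
    Tendsto (fun n : ℕ => ((n : ℝ) + 1) * exp (-(c * n))) atTop (𝓝 0) := by
  have h := (tendsto_pow_mul_exp_neg_mul 1 hc).add (tendsto_pow_mul_exp_neg_mul 0 hc)
  rw [add_zero] at h
  exact h.congr fun n => by ring

theorem eventually_polynomial_le_two_rpow {a : ℝ} (ha : 0 < a) :
    ∀ᶠ n : ℕ in atTop, ((n : ℝ) + 1) * n ^ 2 ≤ a * 2 ^ ((n : ℝ) / 4) := by
  have hc : 0 < log 2 / 4 := by have := log_pos one_lt_two; positivity
  have h := (tendsto_pow_mul_exp_neg_mul 3 hc).add (tendsto_pow_mul_exp_neg_mul 2 hc)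
  rw [add_zero] at h
  filter_upwards [h.eventually_le_const ha] with n hn
  have : (2 : ℝ) ^ ((n : ℝ) / 4) = exp (log 2 / 4 * n) := by
    rw [rpow_def_of_pos two_pos]; congr 1; ring
  rw [this, ← div_le_iff₀ (exp_pos _), div_eq_mul_inv, ← exp_neg]
  linarith

theorem tendsto_succ_mul_exp_neg_two_rpow {a : ℝ} (ha : 0 < a) :
    Tendsto (fun n : ℕ => ((n : ℝ) + 1) * exp (-(a * 2 ^ ((n : ℝ) / 4)))) atTop (𝓝 0) := by
  refine squeeze_zero' (Eventually.of_forall fun n => by positivity) ?_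
    (tendsto_succ_mul_exp_neg_mul one_pos)
  filter_upwards [eventually_polynomial_le_two_rpow ha, eventually_ge_atTop 1] with n hn h1
  have h1 : (1 : ℝ) ≤ n := by exact_mod_cast h1
  refine mul_le_mul_of_nonneg_left (exp_le_exp.2 (neg_le_neg ?_)) (by positivity)
  refine le_trans ?_ hn
  nlinarith

end Limits

/-! ### Conclusion -/

theorem lemma3 (n v : ℕ → ℕ) (hn : Tendsto n atTop atTop)
    (R : ℝ) (hR : R ∈ Set.Ioo (0 : ℝ) 1)
    (hrate : Tendsto (fun k => reedMullerRate (n k) (v k)) atTop (𝓝 R))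
    (z : ℝ) (hz : z ∈ Set.Ioo (0 : ℝ) 1)
    (Y : ℕ → Type*) [∀ k, MeasurableSpace (Y k)]
    (W : ∀ k, ZMod 2 → Measure (Y k)) (hW : ∀ k, IsBMS (W k))
    (hWz : ∀ k, bhattacharyya (W k) = z)
    (β : ℝ) (hβ : 0 < β) :
    Tendsto
      (fun k => randBlockMAPErrorWithin (W k) (reedMullerCodewords (n k) (v k))
        ((2 : ℝ) ^ ((n k : ℝ) * (1 - β))))
      atTop (𝓝 0) := by
  have hL : 0 < -Real.log z := neg_pos.2 (Real.log_neg hz.1 hz.2)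
  set L := -Real.log z with hLdef
  have hzL : Real.exp (-L) = z := by rw [hLdef, neg_neg, Real.exp_log hz.1]
  have hlim : Tendsto (fun k => ENNReal.ofReal
      (((n k : ℝ) + 1) * Real.exp (-(L / 64 * 2 ^ ((n k : ℝ) / 4))))) atTop (𝓝 0) := by
    have := ENNReal.tendsto_ofReal
      ((tendsto_succ_mul_exp_neg_two_rpow (a := L / 64) (by positivity)).comp hn)
    rwa [ENNReal.ofReal_zero] at this
  -- The bound `β / 4` keeps `v - k` well below `m / 2`; the bound `1 / 2` ensures `m ≥ n / 4`
  -- whatever `β` is.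
  have hδ : 0 < min (β / 4) (1 / 2) := lt_min (by positivity) (by norm_num)
  have h5 : ∀ᶠ m : ℕ in atTop, 5 ≤ β * m / 4 := by
    have : Tendsto (fun m : ℕ => β * (m : ℝ) / 4) atTop atTop :=
      (Tendsto.const_mul_atTop hβ tendsto_natCast_atTop_atTop).atTop_div_const (by norm_num)
    exact this.eventually_ge_atTop 5
  refine tendsto_of_tendsto_of_tendsto_of_le_of_le' tendsto_const_nhds hlim
    (Eventually.of_forall fun _ => zero_le) ?_
  filter_upwards [eventually_two_mul_degree_le hn hR.2 hrate hδ, hn.eventually h5,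
    hn.eventually ((tendsto_succ_mul_exp_neg_mul (c := β ^ 2 / 8) (by positivity)).eventually_le_const
      (show 0 < L / 128 by positivity)),
    hn.eventually (eventually_polynomial_le_two_rpow (show 0 < L / 128 by positivity))]
    with k hv h5 hc hpoly
  refine (randBlockMAPErrorWithin_le (hW k) hz.1.ne' (hWz k) _ (fun x hx y hy => ?_) _).trans ?_
  · simp only [reedMullerCodewords, Set.Finite.mem_toFinset, SetLike.mem_coe] at hx hy ⊢
    exact Submodule.sub_mem _ hx hy
  · refine le_trans (le_of_eq ?_) (ENNReal.ofReal_le_ofReal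
      (sum_exp_lowWeight_le hL hβ (min_le_left _ _) (min_le_right _ _) hv h5 hc hpoly))
    rw [ENNReal.ofReal_sum_of_nonneg fun _ _ => by positivity, hzL]
    exact Finset.sum_congr rfl fun c _ => (ENNReal.ofReal_pow hz.1.le _).symm
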